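/- Let $K$ be a subfield of $\mathbb{R}$, with the order and the topology induced from $\mathbb{R}$. Let $\mathcal{K}$ be an expansion of the field $K$, that is, a first-order structure with underlying set $K$ whose language contains the language of rings, interpreted as the field operations of $K$ (the order may, but need not, be named as well). "Definable" means first-order definable in $\mathcal{K}$ with parameters from $K$. Suppose that $\mathcal{K}$ is definably complete, i.e. every nonempty bounded definable subset of $K$ has a supremum in $K$. Then $\mathcal{K}$ is definably Baire: writing $Y_t=\{b\in K : (b,t)\in Y\}$ for $Y\subseteq K\times K$ and $t\in K$, there is no definable set $Y\subseteq K\times K$ such that (i) $Y_t$ is nowhere dense in $K$ for all $t\in K$ with $t>0$, (ii) $Y_s\subseteq Y_t$ for all $s,t\in K$ with $0<s<t$, and (iii) $\bigcup_{t\in K,\ t>0}Y_t=K$. -/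

import Mathlib

universe u v w

open scoped FirstOrder

/-- A linearly ordered `L`-structure `M` is definably complete: every nonempty bounded subset of `M` that
is definable in `M` (with parameters) has a supremum in `M`. -/
def IsDefinablyComplete (L : FirstOrder.Language.{u, v}) (M : Type w) [L.Structure M]
    [LinearOrder M] : Prop :=
  ∀ S : Set M, (Set.univ : Set M).Definable₁ L S → S.Nonempty → BddBelow S → BddAbove S →
    ∃ b : M, IsLUB S b

/-- The fibre `Y_a = {b : (b, a) ∈ Y}`. -/
def fibre {M : Type w} (Y : Set (M × M)) (a : M) : Set M :=
  {b | (b, a) ∈ Y}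

/-- `M` is definably Baire: there is no `Y ⊆ M²`, definable in `M` (with parameters), whose
fibres `Y_t`, for `t > 0`, are nowhere dense, increase with `t` and cover `M`. -/
def IsDefinablyBaire (L : FirstOrder.Language.{u, v}) (M : Type w) [L.Structure M]
    [LinearOrder M] [Zero M] [TopologicalSpace M] : Prop :=
  ¬ ∃ Y : Set (M × M), (Set.univ : Set M).Definable₂ L Y ∧
    (∀ t : M, 0 < t → IsNowhereDense (fibre Y t)) ∧
    (∀ s t : M, 0 < s → s < t → fibre Y s ⊆ fibre Y t) ∧
    (⋃ t ∈ Set.Ioi (0 : M), fibre Y t) = Set.univ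

/-! ### Definable predicates -/

/-! A counterexample `Y` orders the points of K by the time at which they enter the closures of the
increasing fibres. This is a definable total preorder q whose initial segments are closed and
nowhere dense. Definable completeness provides leftmost q-minima on closed intervals
(`exists_leftmost_min`), so the points of (0, 1) that are leftmost minima of some neighbourhood are
dense in it (`exists_localMin`). Such points sharing a radius ε are more than ε apart, hence finite
in number because K is archimedean (`finite_scale`). Ordering them by radius, then by position,
makes them a definable dense set D in which each point has finitely many predecessors.

The Baire argument can now be run definably along D. Inserting D in this order into a binary search
tree gives nested intervals, and a path is to leave the initial segments of all o in D one after
another. Recursion is not definable, so the direction at each node is read off from that node alone: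
it heads for the first descendant that avoids the first segment still met. The path reaches all its
goals (`exists_avoids`), and its limit w, the supremum of a definable set, lies in no initial
segment of a point of D. By totality D lies in the initial segment of w, which is nowhere dense: a
contradiction.

The order of K need not be named, but completeness makes every positive element a square
(`defOrder_of_isDefinablyComplete`). -/

/-- The predicate `p` on tuples is definable with parameters. -/
class DefPred (L : FirstOrder.Language.{u, v}) {M : Type w} [L.Structure M] {α : Type}
    (p : (α → M) → Prop) : Prop where
  out : (Set.univ : Set M).Definable L {v | p v}

/-- The function `f` on tuples is definable with parameters. -/
class DefFun (L : FirstOrder.Language.{u, v}) {M : Type w} [L.Structure M] {α : Type}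
    (f : (α → M) → M) : Prop where
  out : (Set.univ : Set M).DefinableFun L f

section Definability

variable {L : FirstOrder.Language.{u, v}} {M : Type w} [L.Structure M] {α : Type}

instance DefFun.proj (i : α) : DefFun L (fun v : α → M => v i) :=
  ⟨Set.DefinableFun.proj L⟩

instance DefFun.const (a : M) : DefFun L (fun _ : α → M => a) :=
  ⟨L.definableFun_const α (Set.mem_univ a)⟩

section Connectives

variable {p q : (α → M) → Prop}

instance DefPred.and [hp : DefPred L p] [hq : DefPred L q] : DefPred L (fun v => p v ∧ q v) :=
  ⟨hp.out.inter hq.out⟩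

instance DefPred.or [hp : DefPred L p] [hq : DefPred L q] : DefPred L (fun v => p v ∨ q v) :=
  ⟨hp.out.union hq.out⟩

instance DefPred.not [hp : DefPred L p] : DefPred L (fun v => ¬ p v) :=
  ⟨hp.out.compl⟩

theorem DefPred.congr (hp : DefPred L p) (h : ∀ v, q v ↔ p v) : DefPred L q := by
  obtain rfl : q = p := funext fun v => propext (h v)
  exact hp

instance DefPred.imp [DefPred L p] [DefPred L q] : DefPred L (fun v => p v → q v) :=
  DefPred.congr (p := fun v => ¬ p v ∨ q v) inferInstance fun _ => imp_iff_not_or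

instance DefPred.iff [DefPred L p] [DefPred L q] : DefPred L (fun v => p v ↔ q v) :=
  DefPred.congr (p := fun v => (p v → q v) ∧ (q v → p v)) inferInstance
    fun _ => iff_iff_implies_and_implies

instance DefPred.eq {f g : (α → M) → M} [hf : DefFun L f] [hg : DefFun L g] :
    DefPred L (fun v => f v = g v) :=
  ⟨hf.out.ofPred_eq hg.out⟩

end Connectives

section Quantifiers

variable {p : (α → M) → M → Prop}

/-- The bound variable becomes the extra coordinate `.inr ()`, so instance search can peel off
quantifiers one at a time. -/
instance DefPred.exists
    [h : DefPred L (fun w : α ⊕ Unit → M => p (fun i => w (.inl i)) (w (.inr ())))] :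
    DefPred L (fun v => ∃ x, p v x) := by
  refine DefPred.congr ⟨h.out.exists_of_finite⟩ fun v => ?_
  exact ⟨fun ⟨x, hx⟩ => ⟨fun _ => x, hx⟩, fun ⟨u, hu⟩ => ⟨u (), hu⟩⟩

instance DefPred.forall
    [h : DefPred L (fun w : α ⊕ Unit → M => p (fun i => w (.inl i)) (w (.inr ())))] :
    DefPred L (fun v => ∀ x, p v x) := by
  refine DefPred.congr ⟨h.out.forall_of_finite⟩ fun v => ?_
  exact ⟨fun h u => h (u ()), fun h x => h fun _ => x⟩

end Quantifiers

section Relations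

/-- The set `{x | R x}` is definable with parameters. -/
def DefRel₁ (L : FirstOrder.Language.{u, v}) [L.Structure M] (R : M → Prop) : Prop :=
  DefPred L fun v : Fin 1 → M => R (v 0)

/-- The binary relation `R` is definable with parameters. -/
def DefRel₂ (L : FirstOrder.Language.{u, v}) [L.Structure M] (R : M → M → Prop) : Prop :=
  DefPred L fun v : Fin 2 → M => R (v 0) (v 1)

theorem DefRel₁.comp {R : M → Prop} (hR : DefRel₁ L R) {f : (α → M) → M} [hf : DefFun L f] :
    DefPred L (fun v => R (f v)) :=
  ⟨Set.Definable.preimage_map (F := fun v => ![f v]) (by simp [Set.DefinableMap, hf.out]) hR.out⟩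

theorem DefRel₂.comp {R : M → M → Prop} (hR : DefRel₂ L R) {f g : (α → M) → M}
    [hf : DefFun L f] [hg : DefFun L g] : DefPred L (fun v => R (f v) (g v)) :=
  ⟨Set.Definable.preimage_map (F := fun v => ![f v, g v])
    (by simp [Set.DefinableMap, hf.out, hg.out]) hR.out⟩

end Relations
end Definability

/-! ### Paths in binary search trees -/

/-- A binary search tree on the points of `D`, inserted in the order `r`, between the bounds `lo`
and `hi`, together with a family `{c | q c o}` of sets that a path through the tree is to avoid. -/
structure SearchTree (K : Type w) where
  D : K → Prop
  r : K → K → Prop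
  q : K → K → Prop
  lo : K
  hi : K

namespace SearchTree

theorem exists_least {K : Type w} (ρ : K → ℕ) (s : K → Prop) (hs : ∃ x, s x) :
    ∃ x, s x ∧ ∀ y, s y → ρ x ≤ ρ y := by
  obtain ⟨x, hx, hmin⟩ := (measure ρ).wf.has_min {x | s x} hs
  exact ⟨x, hx, fun y hy => not_lt.1 (hmin y hy)⟩

section Defs

variable {K : Type w} [LinearOrder K] (T : SearchTree K)

/-- The point `c` lies in the closed interval of the node `z`. -/
def Hull (z c : K) : Prop :=
  T.lo ≤ c ∧ c ≤ T.hi ∧ ∀ u, T.D u → T.r u z → ¬ (c < u ∧ u < z) ∧ ¬ (z < u ∧ u < c)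

/-- The interval of the node `z` meets the set with index `o`. -/
def Meets (z o : K) : Prop := ∃ c, T.Hull z c ∧ T.q c o

/-- The node `y` is a proper ancestor of the node `x`. -/
def Anc (y x : K) : Prop := T.r y x ∧ T.Hull y x

/-- `o` is the first index whose set the interval of `y` does not avoid yet. -/
def Objective (y o : K) : Prop :=
  T.D o ∧ T.Meets y o ∧ ∀ o', T.D o' → T.r o' o → ¬ T.Meets y o'

/-- `z` is a descendant of `y` whose interval avoids the set with index `o`. -/
def Candidate (y o z : K) : Prop := T.D z ∧ T.Anc y z ∧ ¬ T.Meets z o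

/-- `z` is the first descendant of `y` whose interval avoids the objective of `y`. -/
def Target (y z : K) : Prop :=
  ∃ o, T.Objective y o ∧ T.Candidate y o z ∧ ∀ z', T.r z' z → ¬ T.Candidate y o z'

/-- At the node `y`, the path turns right. -/
def TurnsRight (y : K) : Prop := ∃ z, T.Target y z ∧ y < z

/-- The node `x` lies on the path that always turns towards the target. -/
def OnPath (x : K) : Prop := T.D x ∧ ∀ y, T.D y → T.Anc y x → (y < x ↔ T.TurnsRight y)

/-- The lower endpoints of the intervals along the path. -/
def PathLower (x : K) : Prop := x = T.lo ∨ (T.OnPath x ∧ T.TurnsRight x)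

/-- The conditions under which the path shrinks to a point that avoids all the sets. -/
structure IsRanked (ρ : K → ℕ) : Prop where
  r_iff : ∀ x y, T.D x → T.D y → (T.r x y ↔ ρ x < ρ y)
  inj : ∀ x y, T.D x → T.D y → ρ x = ρ y → x = y
  lo_lt : T.lo < T.hi
  bounds : ∀ x, T.D x → T.lo < x ∧ x < T.hi
  dense : ∀ a b, T.lo ≤ a → a < b → b ≤ T.hi → ∃ d, T.D d ∧ a < d ∧ d < b
  q_sparse : ∀ o a b, a < b → ∃ a' b', a ≤ a' ∧ a' < b' ∧ b' ≤ b ∧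
    ∀ c, a' < c → c < b' → ¬ T.q c o

end Defs

/-! ### Ancestors, nested intervals and the limit of the path -/

section Path

variable {K : Type w} [LinearOrder K] {T : SearchTree K} {ρ : K → ℕ}

theorem IsRanked.hull_iff (h : T.IsRanked ρ) {z c : K} (hz : T.D z) :
    T.Hull z c ↔ T.lo ≤ c ∧ c ≤ T.hi ∧
      ∀ u, T.D u → ρ u < ρ z → ¬ (c < u ∧ u < z) ∧ ¬ (z < u ∧ u < c) := by
  unfold Hull
  refine and_congr_right fun _ => and_congr_right fun _ => forall_congr' fun u => ?_
  exact imp_congr_right fun hu => by rw [h.r_iff u z hu hz]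

theorem IsRanked.anc_iff (h : T.IsRanked ρ) {y x : K} (hy : T.D y) (hx : T.D x) :
    T.Anc y x ↔ ρ y < ρ x ∧
      ∀ u, T.D u → ρ u < ρ y → ¬ (x < u ∧ u < y) ∧ ¬ (y < u ∧ u < x) := by
  unfold Anc
  rw [h.hull_iff hy, h.r_iff y x hy hx]
  simp [(h.bounds x hx).1.le, (h.bounds x hx).2.le]

theorem IsRanked.anc_trans (h : T.IsRanked ρ) {x y z : K} (hx : T.D x) (hy : T.D y) (hz : T.D z)
    (hxy : T.Anc x y) (hyz : T.Anc y z) : T.Anc x z := by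
  rw [h.anc_iff hx hy] at hxy
  rw [h.anc_iff hy hz] at hyz
  rw [h.anc_iff hx hz]
  grind

/-- Two ancestors of a node are comparable. -/
theorem IsRanked.anc_of_anc (h : T.IsRanked ρ) {x y z : K} (hx : T.D x) (hy : T.D y) (hz : T.D z)
    (hxz : T.Anc x z) (hyz : T.Anc y z) (hlt : ρ x < ρ y) : T.Anc x y := by
  rw [h.anc_iff hx hz] at hxz
  rw [h.anc_iff hy hz] at hyz
  rw [h.anc_iff hx hy]
  grind

/-- Ancestors of `x` lie on the same side of `x` as of the descendants of `x`. -/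
theorem IsRanked.lt_iff_of_anc (h : T.IsRanked ρ) {x y z : K} (hx : T.D x) (hy : T.D y)
    (hz : T.D z) (hxy : T.Anc x y) (hyz : T.Anc y z) : x < y ↔ x < z := by
  have hxz := h.anc_trans hx hy hz hxy hyz
  rw [h.anc_iff hx hy] at hxy
  rw [h.anc_iff hy hz] at hyz
  rw [h.anc_iff hx hz] at hxz
  grind

theorem IsRanked.hull_subset (h : T.IsRanked ρ) {x y c : K} (hx : T.D x) (hy : T.D y)
    (hxy : T.Anc x y) (hc : T.Hull y c) : T.Hull x c := by
  rw [h.anc_iff hx hy] at hxy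
  rw [h.hull_iff hy] at hc
  rw [h.hull_iff hx]
  grind

theorem IsRanked.meets_of_anc (h : T.IsRanked ρ) {x y o : K} (hx : T.D x) (hy : T.D y)
    (hxy : T.Anc x y) (hc : T.Meets y o) : T.Meets x o :=
  hc.imp fun _ hc => ⟨h.hull_subset hx hy hxy hc.1, hc.2⟩

/-- If `u` is inserted before `x`, then `x` has an ancestor between `u` and `x`, possibly `u`. -/
theorem IsRanked.exists_anc_between (h : T.IsRanked ρ) {x u : K} (hx : T.D x) (hu : T.D u)
    (hux : ρ u < ρ x) : ∃ m, T.D m ∧ T.Anc m x ∧ ρ m ≤ ρ u ∧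
      (x < u → x < m ∧ m ≤ u) ∧ (u < x → u ≤ m ∧ m < x) := by
  obtain ⟨m, ⟨hm, hmb⟩, hmin⟩ := exists_least ρ
    (fun m => T.D m ∧ ((x ≤ m ∧ m ≤ u) ∨ (u ≤ m ∧ m ≤ x))) ⟨u, hu, by grind⟩
  have hmu := hmin u ⟨hu, by grind⟩
  refine ⟨m, hm, ?_, hmu, ?_⟩
  · rw [h.anc_iff hm hx]
    grind
  · grind

theorem IsRanked.onPath_of_anc (h : T.IsRanked ρ) {x y : K} (hy : T.D y) (hx : T.OnPath x)
    (hyx : T.Anc y x) : T.OnPath y := by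
  refine ⟨hy, fun z hz hzy => ?_⟩
  rw [h.lt_iff_of_anc hz hy hx.1 hzy hyx]
  exact hx.2 z hz (h.anc_trans hz hy hx.1 hzy hyx)

/-- The nodes on the path form a chain. -/
theorem IsRanked.anc_of_onPath (h : T.IsRanked ρ) {x y : K} (hx : T.OnPath x) (hy : T.OnPath y)
    (hxy : ρ x < ρ y) : T.Anc x y := by
  by_contra hcon
  have hcon' := hcon
  rw [h.anc_iff hx.1 hy.1] at hcon
  obtain ⟨u, hu, hux, hb⟩ : ∃ u, T.D u ∧ ρ u < ρ x ∧ ((y < u ∧ u < x) ∨ (x < u ∧ u < y)) := by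
    grind
  -- The earliest node between `x` and `y` is an ancestor of both and separates them, so the path
  -- would have to turn both ways there.
  obtain ⟨m, ⟨hm, hmb⟩, hmin⟩ := exists_least ρ
    (fun m => T.D m ∧ ((y ≤ m ∧ m ≤ x) ∨ (x ≤ m ∧ m ≤ y))) ⟨u, hu, by grind⟩
  have hmu := hmin u ⟨hu, by grind⟩
  have h1 : T.Anc m x := by
    rw [h.anc_iff hm hx.1]
    grind
  have h2 : T.Anc m y := by
    rw [h.anc_iff hm hy.1]
    grind
  have h3 := hx.2 m hm h1
  have h4 := hy.2 m hm h2
  grind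

/-- The supremum of the lower endpoints lies in all intervals along the path. -/
theorem IsRanked.hull_of_isLUB (h : T.IsRanked ρ) {w x : K} (hw : IsLUB {c | T.PathLower c} w)
    (hx : T.OnPath x) : T.Hull x w := by
  rw [h.hull_iff hx.1]
  refine ⟨hw.1 (Or.inl rfl), hw.2 ?_, fun u hu hux => ⟨fun hb => ?_, fun hb => ?_⟩⟩
  · rintro c (rfl | hc)
    · exact ((h.bounds x hx.1).1.trans (h.bounds x hx.1).2).le
    · exact (h.bounds c hc.1.1).2.le
  -- An ancestor of `x` in [u, x) is a right turn of the path, hence at most `w`.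
  · obtain ⟨m, hm, hmx, -, -, hmb⟩ := h.exists_anc_between hx.1 hu hux
    have hmb := hmb hb.2
    have : m ≤ w := hw.1 (Or.inr ⟨h.onPath_of_anc hm hx hmx, (hx.2 m hm hmx).1 hmb.2⟩)
    grind
  -- Some lower endpoint `c` lies beyond `u`. As a descendant of `x` it would be cut off by `u`; as
  -- an ancestor with a right turn it would lie left of `x`.
  · obtain ⟨c, hc, huc⟩ := (lt_isLUB_iff hw).1 hb.2
    rcases hc with rfl | hc
    · exact absurd (h.bounds u hu).1 huc.not_gt
    · rcases lt_trichotomy (ρ x) (ρ c) with hlt | heq | hlt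
      · have := (h.anc_iff hx.1 hc.1.1).1 (h.anc_of_onPath hx hc.1 hlt)
        grind
      · have := h.inj x c hx.1 hc.1.1 heq
        grind
      · have := (hx.2 c hc.1.1 (h.anc_of_onPath hc.1 hx hlt)).2 hc.2
        grind

/-- Two distinct nodes of an interval have distinct ranks, so they cannot both have rank exactly
`n`. -/
theorem IsRanked.exists_rank_le (h : T.IsRanked ρ) (n : ℕ) :
    ∀ a b, T.lo ≤ a → a < b → b ≤ T.hi → ∃ d, T.D d ∧ a < d ∧ d < b ∧ n ≤ ρ d := by
  induction n with
  | zero => simpa using h.dense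
  | succ n ih =>
    intro a b ha hab hb
    obtain ⟨d, hd, had, hdb, hn⟩ := ih a b ha hab hb
    obtain ⟨e, he, hae, hed, hn'⟩ := ih a d ha had (hdb.le.trans hb)
    have := h.inj d e hd he
    rcases hn.eq_or_lt with hn | hn
    · exact ⟨e, he, hae, hed.trans hdb, by grind⟩
    · exact ⟨d, hd, had, hdb, hn⟩

/-- Every node has a descendant whose interval avoids a given set. -/
theorem IsRanked.exists_candidate (h : T.IsRanked ρ) {x : K} (hx : T.D x) (o : K) :
    ∃ z, T.Candidate x o z := by
  -- A gap to the right of `x` free of earlier nodes exists because ranks are injective: each rank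
  -- below that of `x` shrinks `b` at most once.
  obtain ⟨b, hxb, hb, hfree⟩ : ∃ b, x < b ∧ b ≤ T.hi ∧
      ∀ u, T.D u → ρ u < ρ x → ¬ (x < u ∧ u < b) := by
    induction ρ x with
    | zero => exact ⟨T.hi, (h.bounds x hx).2, le_rfl, by simp⟩
    | succ n ih =>
      obtain ⟨b, hxb, hb, hfree⟩ := ih
      by_cases hn : ∃ u, T.D u ∧ ρ u = n ∧ x < u ∧ u < b
      · obtain ⟨u, hu, hun, hxu, hub⟩ := hn
        have := fun v hv => h.inj u v hu hv
        exact ⟨u, hxu, hub.le.trans hb, by grind⟩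
      · exact ⟨b, hxb, hb, by grind⟩
  obtain ⟨a', b', ha, hab, hb', hq⟩ := h.q_sparse o x b hxb
  have hlo := (h.bounds x hx).1
  obtain ⟨d, hd, had, hdb⟩ := h.dense a' b' (by grind) hab (by grind)
  obtain ⟨e, he, hde, heb⟩ := h.dense d b' (by grind) hdb (by grind)
  -- Being inserted after `d` and `e`, the node `z` has its closed interval inside [d, e], hence
  -- strictly inside (a', b').
  obtain ⟨z, hz, hdz, hze, hn⟩ :=
    h.exists_rank_le (ρ x + ρ d + ρ e + 1) d e (by grind) hde (by grind)
  refine ⟨z, hz, ?_, ?_⟩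
  · rw [h.anc_iff hx hz]
    grind
  · rintro ⟨c, hc, hqc⟩
    rw [h.hull_iff hz] at hc
    have h1 := hc.2.2 d hd (by grind)
    have h2 := hc.2.2 e he (by grind)
    exact hq c (by grind) (by grind) hqc

/-- Once the path is at a node whose first unavoided index is `o`, it keeps one target `z` until it
arrives there: the nodes on the way still meet the set of `o`, since otherwise one of them would be
an earlier candidate, and they inherit the objective and the target. Avoidance persists because
intervals shrink. -/
theorem IsRanked.exists_avoids (h : T.IsRanked ρ) (n : ℕ) :
    ∃ x, T.OnPath x ∧ ∀ o, T.D o → ρ o < n → ¬ T.Meets x o := by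
  induction n with
  | zero =>
    obtain ⟨d, hd, -⟩ : ∃ d, T.D d ∧ _ := h.dense _ _ le_rfl h.lo_lt le_rfl
    obtain ⟨x, hx, hmin⟩ := exists_least ρ T.D ⟨d, hd⟩
    refine ⟨x, ⟨hx, fun y hy hyx => ?_⟩, by simp⟩
    have := ((h.anc_iff hy hx).1 hyx).1
    grind
  | succ n ih =>
    obtain ⟨x, hx, hav⟩ := ih
    by_cases hn : ∃ o, T.D o ∧ ρ o = n ∧ T.Meets x o
    swap
    · exact ⟨x, hx, by grind⟩
    obtain ⟨o, ho, hon, hxo⟩ := hn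
    have hobj : ∀ y, T.D y → (y = x ∨ T.Anc x y) → T.Meets y o → T.Objective y o := by
      intro y hy hyx hyo
      refine ⟨ho, hyo, fun o' ho' hlt hm => ?_⟩
      rw [h.r_iff o' o ho' ho] at hlt
      rcases hyx with rfl | hyx
      · exact hav o' ho' (hon ▸ hlt) hm
      · exact hav o' ho' (hon ▸ hlt) (h.meets_of_anc hx.1 hy hyx hm)
    obtain ⟨z, hz, hmin⟩ := exists_least ρ (T.Candidate x o) (h.exists_candidate hx.1 o)
    obtain ⟨hzD, hxz, hzo⟩ := hz
    have htarget : ∀ y, T.D y → (y = x ∨ T.Anc x y) → T.Anc y z → T.Meets y o → T.Target y z := by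
      intro y hy hyx hyz hyo
      refine ⟨o, hobj y hy hyx hyo, ⟨hzD, hyz, hzo⟩, fun z' hlt hc => ?_⟩
      rw [h.r_iff z' z hc.1 hzD] at hlt
      refine absurd (hmin z' ⟨hc.1, ?_, hc.2.2⟩) hlt.not_ge
      rcases hyx with rfl | hyx
      · exact hc.2.1
      · exact h.anc_trans hx.1 hy hc.1 hyx hc.2.1
    have hright : ∀ y, T.D y → T.Target y z → (y < z ↔ T.TurnsRight y) := by
      intro y hy ht
      refine ⟨fun hlt => ⟨z, ht, hlt⟩, ?_⟩
      rintro ⟨z', ht', hlt⟩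
      suffices z' = z by rwa [this] at hlt
      obtain ⟨o₁, ho₁, hc₁, hm₁⟩ := ht
      obtain ⟨o₂, ho₂, hc₂, hm₂⟩ := ht'
      have e : o₁ = o₂ := by
        have h1 := ho₁.2.2 o₂ ho₂.1
        have h2 := ho₂.2.2 o₁ ho₁.1
        rw [h.r_iff _ _ ho₂.1 ho₁.1] at h1
        rw [h.r_iff _ _ ho₁.1 ho₂.1] at h2
        refine h.inj _ _ ho₁.1 ho₂.1 ?_
        have := ho₁.2.1
        have := ho₂.2.1
        grind
      subst e
      have h1 := hm₁ z'
      have h2 := hm₂ z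
      rw [h.r_iff _ _ hc₂.1 hc₁.1] at h1
      rw [h.r_iff _ _ hc₁.1 hc₂.1] at h2
      refine h.inj _ _ hc₂.1 hc₁.1 ?_
      grind
    refine ⟨z, ⟨hzD, fun y hy hyz => ?_⟩, fun o' ho' hlt hm => ?_⟩
    · rcases lt_trichotomy (ρ y) (ρ x) with hlt | heq | hlt
      · have hyx := h.anc_of_anc hy hx.1 hzD hyz hxz hlt
        rw [← h.lt_iff_of_anc hy hx.1 hzD hyx hxz]
        exact hx.2 y hy hyx
      · obtain rfl := h.inj y x hy hx.1 heq
        exact hright y hy (htarget y hy (Or.inl rfl) hyz hxo)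
      · have hxy := h.anc_of_anc hx.1 hy hzD hxz hyz hlt
        -- A node strictly between `x` and `z` that already avoided `o` would be a candidate earlier
        -- than `z`.
        refine hright y hy (htarget y hy (Or.inr hxy) hyz ?_)
        by_contra hyo
        exact absurd (hmin y ⟨hy, hxy, hyo⟩) ((h.anc_iff hy hzD).1 hyz).1.not_ge
    · rcases Nat.lt_succ_iff_lt_or_eq.1 hlt with hlt | heq
      · exact hav o' ho' hlt (h.meets_of_anc hx.1 hzD hxz hm)
      · obtain rfl := h.inj o' o ho' ho (heq.trans hon.symm)
        exact hzo hm

/-- The limit point of the path avoids all the sets. -/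
theorem IsRanked.not_q_of_isLUB (h : T.IsRanked ρ) {w o : K} (hw : IsLUB {c | T.PathLower c} w)
    (ho : T.D o) : ¬ T.q w o := by
  obtain ⟨x, hx, hav⟩ := h.exists_avoids (ρ o + 1)
  exact fun hq => hav o ho (Nat.lt_succ_self _) ⟨w, h.hull_of_isLUB hw hx, hq⟩

end Path
end SearchTree

/-! ### Definability of order relations -/

section OrderDefinability

variable {L : FirstOrder.Language.{u, v}} {M : Type w} [L.Structure M] [LinearOrder M]

/-- The order relation is definable with parameters. -/
class DefOrder (L : FirstOrder.Language.{u, v}) (M : Type w) [L.Structure M] [LinearOrder M] :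
    Prop where
  out : DefRel₂ L fun x y : M => x ≤ y

variable [h : DefOrder L M] {α : Type} {f g : (α → M) → M} [DefFun L f] [DefFun L g]

instance DefPred.le : DefPred L (fun v => f v ≤ g v) := h.out.comp

instance DefPred.lt : DefPred L (fun v => f v < g v) :=
  DefPred.congr (p := fun v => ¬ g v ≤ f v) inferInstance fun _ => not_le.symm

end OrderDefinability

namespace SearchTree

/-- The limit of the path through a definable search tree is the supremum of a definable set. -/
theorem defRel_pathLower {L : FirstOrder.Language.{u, v}} {K : Type w} [L.Structure K]
    [LinearOrder K] [DefOrder L K] {T : SearchTree K} (hD : DefRel₁ L T.D) (hr : DefRel₂ L T.r)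
    (hq : DefRel₂ L T.q) : DefRel₁ L T.PathLower := by
  have iD {α : Type} {f : (α → K) → K} [DefFun L f] : DefPred L (fun v => T.D (f v)) := hD.comp
  have ir {α : Type} {f g : (α → K) → K} [DefFun L f] [DefFun L g] :
    DefPred L (fun v => T.r (f v) (g v)) := hr.comp
  have iq {α : Type} {f g : (α → K) → K} [DefFun L f] [DefFun L g] :
    DefPred L (fun v => T.q (f v) (g v)) := hq.comp
  have hHull : DefRel₂ L T.Hull := by unfold DefRel₂ Hull; infer_instance
  have iHull {α : Type} {f g : (α → K) → K} [DefFun L f] [DefFun L g] :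
    DefPred L (fun v => T.Hull (f v) (g v)) := hHull.comp
  have hMeets : DefRel₂ L T.Meets := by unfold DefRel₂ Meets; infer_instance
  have iMeets {α : Type} {f g : (α → K) → K} [DefFun L f] [DefFun L g] :
    DefPred L (fun v => T.Meets (f v) (g v)) := hMeets.comp
  have hAnc : DefRel₂ L T.Anc := by unfold DefRel₂ Anc; infer_instance
  have iAnc {α : Type} {f g : (α → K) → K} [DefFun L f] [DefFun L g] :
    DefPred L (fun v => T.Anc (f v) (g v)) := hAnc.comp
  have hTurn : DefRel₁ L T.TurnsRight := by
    unfold DefRel₁ TurnsRight Target Objective Candidate; infer_instance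
  have iTurn {α : Type} {f : (α → K) → K} [DefFun L f] :
    DefPred L (fun v => T.TurnsRight (f v)) := hTurn.comp
  unfold DefRel₁ PathLower OnPath
  infer_instance

end SearchTree

/-! ### Definable preorders with closed nowhere dense initial segments -/

/-- A total preorder whose initial segments are closed and have dense complement. -/
structure IsSparsePreorder {K : Type w} [LinearOrder K] (q : K → K → Prop) : Prop where
  total : ∀ x y, q x y ∨ q y x
  trans : ∀ x y z, q x y → q y z → q x z
  closed : ∀ x z, ¬ q z x → ∃ a b, a < z ∧ z < b ∧ ∀ c, a < c → c < b → ¬ q c x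
  sparse : ∀ x a b, a < b → ∃ c, a < c ∧ c < b ∧ ¬ q c x

namespace IsSparsePreorder

/-! ### Leftmost minima on closed intervals -/

section Minimum

variable {L : FirstOrder.Language.{u, v}} {K : Type w} [L.Structure K] [LinearOrder K]
  {q : K → K → Prop}

theorem exists_interval (h : IsSparsePreorder q) (o a b : K) (hab : a < b) :
    ∃ a' b', a ≤ a' ∧ a' < b' ∧ b' ≤ b ∧ ∀ c, a' < c → c < b' → ¬ q c o := by
  obtain ⟨z, haz, hzb, hz⟩ := h.sparse o a b hab
  obtain ⟨c, d, hc, hd, hcd⟩ := h.closed o z hz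
  exact ⟨max a c, min b d, by grind, by grind, by grind, fun e h1 h2 => hcd e (by grind) (by grind)⟩

/-- A closed interval contains a leftmost minimal point. -/
theorem exists_leftmost_min [DenselyOrdered K] [DefOrder L K] (hK : IsDefinablyComplete L K)
    (h : IsSparsePreorder q) (hq : DefRel₂ L q) {a b : K} (hab : a ≤ b) :
    ∃ m, a ≤ m ∧ m ≤ b ∧ (∀ z, a ≤ z → z < m → ¬ q z m) ∧ ∀ z, a ≤ z → z ≤ b → q m z := by
  have iq {α : Type} {f g : (α → K) → K} [DefFun L f] [DefFun L g] :
    DefPred L (fun v => q (f v) (g v)) := hq.comp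
  have hA : DefRel₁ L fun x : K =>
      a ≤ x ∧ ∃ y, x ≤ y ∧ y ≤ b ∧ ∀ z, a ≤ z → z < x → ¬ q z y := by
    unfold DefRel₁; infer_instance
  -- The set consists of the `x` for which some point of [x, b] strictly beats all of [a, x); its
  -- supremum is the leftmost minimum.
  obtain ⟨m, hm⟩ := hK {x | a ≤ x ∧ ∃ y, x ≤ y ∧ y ≤ b ∧ ∀ z, a ≤ z → z < x → ¬ q z y}
    hA.out ⟨a, le_rfl, a, by grind⟩ ⟨a, fun x hx => hx.1⟩ ⟨b, fun x ⟨_, y, hy⟩ => hy.1.trans hy.2.1⟩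
  have ham : a ≤ m := hm.1 ⟨le_rfl, a, by grind⟩
  have hmb : m ≤ b := hm.2 fun x ⟨_, y, hy⟩ => hy.1.trans hy.2.1
  have hbeat : ∀ z, z < m → ∃ x, z < x ∧ x ≤ m ∧ a ≤ x ∧ ∃ y, x ≤ y ∧ y ≤ b ∧
      ∀ z, a ≤ z → z < x → ¬ q z y := by
    intro z hz
    obtain ⟨x, hx, hzx⟩ := (lt_isLUB_iff hm).1 hz
    exact ⟨x, hzx, hm.1 hx, hx.1, hx.2⟩
  have hmin : ∀ z, a ≤ z → z ≤ b → q m z := by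
    intro y hay hyb
    by_contra hmy
    obtain ⟨c, d, hcm, hmd, hcd⟩ := h.closed y m hmy
    have hyy : q y y := (h.total y y).elim id id
    obtain ⟨e, hme, hed⟩ := exists_between hmd
    -- The smaller of `y` and a witness for some `x > c` beats all of [a, c]. Near `m` nothing lies
    -- below `y`, so `w` is at least `d` and beats all of [a, e), which pushes the supremum past
    -- `m`.
    obtain ⟨w, haw, hwb, hwy, hwz⟩ : ∃ w, a ≤ w ∧ w ≤ b ∧ q w y ∧
        ∀ z, a ≤ z → z ≤ c → ¬ q z w := by
      obtain ⟨x, hcx, -, hax, y₁, hxy, hyb₁, hlt⟩ := hbeat c hcm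
      rcases h.total y₁ y with h1 | h1
      · exact ⟨y₁, by grind, hyb₁, h1, by grind⟩
      · refine ⟨y, hay, hyb, hyy, fun z haz hzc hzy => ?_⟩
        exact hlt z haz (by grind) (h.trans _ _ _ hzy h1)
    by_cases hdw : d ≤ w
    · have : e ≤ m := hm.1 ⟨by grind, w, by grind, hwb, fun z haz hze hzw => by
        have := h.trans _ _ _ hzw hwy
        grind⟩
      grind
    · have hww : q w w := (h.total w w).elim id id
      grind
  refine ⟨m, ham, hmb, fun z haz hzm hqz => ?_, hmin⟩
  obtain ⟨x, hzx, hxm, hax, y, hxy, hyb, hlt⟩ := hbeat z hzm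
  exact hlt z haz hzx (h.trans _ _ _ hqz (hmin y (by grind) hyb))

end Minimum

/-! ### Local minima ordered by scale -/

section Scale

variable {K : Type w} [Field K] [LinearOrder K]

/-- `x` is the leftmost minimal point of `[x - ε, x + ε]`. -/
def Scale (q : K → K → Prop) (x ε : K) : Prop :=
  0 < ε ∧ (∀ y, x ≤ y + ε → y < x → ¬ q y x) ∧ ∀ y, x < y → y ≤ x + ε → q x y

/-- The points of `(0, 1)` that are leftmost minimal points of a neighbourhood. -/
def LocalMin (q : K → K → Prop) (x : K) : Prop := 0 < x ∧ x < 1 ∧ ∃ ε, Scale q x ε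

/-- The order of the local minima by the size of the neighbourhoods, and then by the position. -/
def Precedes (q : K → K → Prop) (x y : K) : Prop :=
  (∃ ε, Scale q x ε ∧ ¬ Scale q y ε) ∨ ((∀ ε, Scale q x ε ↔ Scale q y ε) ∧ x < y)

variable {q : K → K → Prop}

theorem Scale.lt_of_lt {x y ε : K} (hx : Scale q x ε) (hy : Scale q y ε) (hxy : x < y) :
    x + ε < y := by
  by_contra! hle
  exact hy.2.1 x hle hxy (hx.2.2 y hxy hle)

theorem precedes_irrefl (x : K) : ¬ Precedes q x x := by
  rintro (⟨ε, h1, h2⟩ | h)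
  · exact h2 h1
  · exact h.2.false

theorem precedes_trichotomy (x y : K) : Precedes q x y ∨ x = y ∨ Precedes q y x := by
  by_cases h1 : ∃ ε, Scale q x ε ∧ ¬ Scale q y ε
  · exact Or.inl (Or.inl h1)
  by_cases h2 : ∃ ε, Scale q y ε ∧ ¬ Scale q x ε
  · exact Or.inr (Or.inr (Or.inl h2))
  push Not at h1 h2
  rcases lt_trichotomy x y with h | h | h
  · exact Or.inl (Or.inr ⟨fun ε => ⟨h1 ε, h2 ε⟩, h⟩)
  · exact Or.inr (Or.inl h)
  · exact Or.inr (Or.inr (Or.inr ⟨fun ε => ⟨h2 ε, h1 ε⟩, h⟩))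

variable [IsStrictOrderedRing K]

theorem Scale.mono {x ε δ : K} (h : Scale q x ε) (hδ : 0 < δ) (hle : δ ≤ ε) : Scale q x δ :=
  ⟨hδ, fun y h1 h2 => h.2.1 y (by linarith) h2, fun y h1 h2 => h.2.2 y h1 (by linarith)⟩

/-- The radii of a point are closed downwards among positive elements, so the sets of radii of two
points are nested. -/
theorem Precedes.scale {x y ε : K} (h : Precedes q x y) (hy : Scale q y ε) : Scale q x ε := by
  rcases h with ⟨δ, hx, hny⟩ | h
  · refine hx.mono hy.1 ?_
    by_contra! hlt
    exact hny (hy.mono hx.1 hlt.le)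
  · exact (h.1 ε).2 hy

theorem precedes_trans {x y z : K} (hxy : Precedes q x y) (hyz : Precedes q y z) :
    Precedes q x z := by
  by_cases h : ∃ ε, Scale q x ε ∧ ¬ Scale q z ε
  · exact Or.inl h
  · push Not at h
    have h1 : ∀ ε, Scale q z ε → Scale q y ε := fun ε => hyz.scale
    have h2 : ∀ ε, Scale q y ε → Scale q x ε := fun ε => hxy.scale
    refine Or.inr ⟨fun ε => ⟨h ε, fun hz => h2 ε (h1 ε hz)⟩, ?_⟩
    rcases hxy with ⟨ε, hx, hy⟩ | hxy
    · exact absurd (h1 ε (h ε hx)) hy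
    rcases hyz with ⟨ε, hy, hz⟩ | hyz
    · exact absurd (h ε (h2 ε hy)) hz
    exact hxy.2.trans hyz.2

/-- Points sharing the radius ε are more than ε apart, so each cell of length ε contains at most
one. -/
theorem finite_scale [Archimedean K] (q : K → K → Prop) {ε : K} (hε : 0 < ε) :
    {x | 0 < x ∧ x < 1 ∧ Scale q x ε}.Finite := by
  let := Archimedean.floorRing K
  refine Set.Finite.of_injOn (f := fun x : K => ⌊x / ε⌋) (t := Set.Icc 0 ⌊1 / ε⌋) ?_ ?_
    (Set.finite_Icc _ _)
  · rintro x ⟨h0, h1, -⟩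
    exact ⟨Int.floor_nonneg.2 (by positivity), Int.floor_le_floor (by gcongr)⟩
  · rintro x ⟨-, -, hx⟩ y ⟨-, -, hy⟩ hxy
    have hlt := Int.abs_sub_lt_one_of_floor_eq_floor hxy
    rw [← sub_div, abs_div, abs_of_pos hε, div_lt_one hε, abs_lt] at hlt
    rcases lt_trichotomy x y with h | h | h
    · linarith [hx.lt_of_lt hy h]
    · exact h
    · linarith [hy.lt_of_lt hx h]

theorem finite_precedes [Archimedean K] {y : K} (hy : LocalMin q y) :
    {x | LocalMin q x ∧ Precedes q x y}.Finite := by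
  obtain ⟨-, -, ε, hε⟩ := hy
  exact (finite_scale q hε.1).subset fun x hx => ⟨hx.1.1, hx.1.2.1, hx.2.scale hε⟩

theorem precedes_iff_ncard_lt [Archimedean K] {x y : K} (hx : LocalMin q x) (hy : LocalMin q y) :
    Precedes q x y ↔
      {z | LocalMin q z ∧ Precedes q z x}.ncard < {z | LocalMin q z ∧ Precedes q z y}.ncard := by
  have key : ∀ {x y : K}, LocalMin q x → LocalMin q y → Precedes q x y →
      {z | LocalMin q z ∧ Precedes q z x}.ncard < {z | LocalMin q z ∧ Precedes q z y}.ncard := by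
    intro x y hx hy hxy
    refine Set.ncard_lt_ncard ⟨fun z hz => ⟨hz.1, precedes_trans hz.2 hxy⟩, fun hsub => ?_⟩
      (finite_precedes hy)
    exact precedes_irrefl x (hsub ⟨hx, hxy⟩).2
  refine ⟨key hx hy, fun hlt => ?_⟩
  rcases precedes_trichotomy (q := q) x y with h | h | h
  · exact h
  · exact absurd hlt (by simp [h])
  · exact absurd hlt (key hy hx h).not_gt

variable {L : FirstOrder.Language.{u, v}} [L.Structure K] [DefOrder L K]

theorem exists_localMin (hK : IsDefinablyComplete L K) (h : IsSparsePreorder q)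
    (hq : DefRel₂ L q) {a b : K} (ha : 0 ≤ a) (hab : a < b) (hb : b ≤ 1) :
    ∃ d, LocalMin q d ∧ a < d ∧ d < b := by
  obtain ⟨x, hax, hxb⟩ := exists_between hab
  -- Endpoints outside the initial segment of `x` force the minimum of [p, r] into the interior,
  -- which leaves room for a radius.
  obtain ⟨p, hap, hpx, hp⟩ := h.sparse x a x hax
  obtain ⟨r, hxr, hrb, hr⟩ := h.sparse x x b hxb
  obtain ⟨m, hpm, hmr, hleft, hmin⟩ := exists_leftmost_min hK h hq (hpx.trans hxr).le
  have hmx := hmin x hpx.le hxr.le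
  have hpm' : p < m := lt_of_le_of_ne hpm (by rintro rfl; exact hp hmx)
  have hmr' : m < r := lt_of_le_of_ne hmr (by rintro rfl; exact hr hmx)
  refine ⟨m, ⟨by linarith, by linarith, min (m - p) (r - m), ?_, fun y h1 h2 => ?_,
    fun y h1 h2 => ?_⟩, by linarith, by linarith⟩
  · exact lt_min (by linarith) (by linarith)
  · exact hleft y (by linarith [min_le_left (m - p) (r - m)]) h2
  · exact hmin y (by linarith) (by linarith [min_le_right (m - p) (r - m)])

/-- A definably complete archimedean ordered field has no definable total preorder whose initial
segments are closed and nowhere dense. -/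
theorem false_of_isDefinablyComplete [Archimedean K] (hK : IsDefinablyComplete L K)
    [hadd : DefFun L fun v : Fin 2 → K => v 0 + v 1] (h : IsSparsePreorder q)
    (hq : DefRel₂ L q) : False := by
  let T : SearchTree K := ⟨LocalMin q, Precedes q, q, 0, 1⟩
  have hT : T.IsRanked fun x => {z | LocalMin q z ∧ Precedes q z x}.ncard :=
    { r_iff := fun x y hx hy => precedes_iff_ncard_lt hx hy
      inj := fun x y hx hy hxy => by
        rcases precedes_trichotomy (q := q) x y with h | h | h
        · exact absurd ((precedes_iff_ncard_lt hx hy).1 h) hxy.not_lt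
        · exact h
        · exact absurd ((precedes_iff_ncard_lt hy hx).1 h) hxy.not_gt
      lo_lt := zero_lt_one
      bounds := fun x hx => ⟨hx.1, hx.2.1⟩
      dense := fun a b ha hab hb => exists_localMin hK h hq ha hab hb
      q_sparse := h.exists_interval }
  have iadd {α : Type} {f g : (α → K) → K} [hf : DefFun L f] [hg : DefFun L g] :
      DefFun L (fun v => f v + g v) :=
    ⟨Set.DefinableFun.comp (g := fun v => ![f v, g v])
      (by simp [Set.DefinableMap, hf.out, hg.out]) hadd.out⟩
  have iq {α : Type} {f g : (α → K) → K} [DefFun L f] [DefFun L g] :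
    DefPred L (fun v => q (f v) (g v)) := hq.comp
  have hscale : DefRel₂ L (Scale q) := by unfold DefRel₂ Scale; infer_instance
  have iscale {α : Type} {f g : (α → K) → K} [DefFun L f] [DefFun L g] :
    DefPred L (fun v => Scale q (f v) (g v)) := hscale.comp
  have hD : DefRel₁ L (LocalMin q) := by unfold DefRel₁ LocalMin; infer_instance
  have hr : DefRel₂ L (Precedes q) := by unfold DefRel₂ Precedes; infer_instance
  have hP : DefRel₁ L T.PathLower := SearchTree.defRel_pathLower hD hr hq
  obtain ⟨w, hw⟩ := hK {c | T.PathLower c} hP.out ⟨0, Or.inl rfl⟩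
    ⟨0, by rintro c (rfl | hc); exacts [le_rfl, hc.1.1.1.le]⟩
    ⟨1, by rintro c (rfl | hc); exacts [zero_le_one, hc.1.1.2.1.le]⟩
  -- The initial segment of `w` misses an interval, which contains a node `d`. Totality gives `q w
  -- d`, which the path has excluded.
  obtain ⟨a, b, ha, hab, hb, hab'⟩ := h.exists_interval w 0 1 zero_lt_one
  obtain ⟨d, hd, had, hdb⟩ := exists_localMin hK h hq ha hab hb
  exact (h.total w d).elim (hT.not_q_of_isLUB hw hd) (hab' d had hdb)

end Scale

end IsSparsePreorder

/-! ### Expansions of subfields of the real numbers -/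

section SubfieldReal

variable {K : Subfield ℝ}

theorem Subfield.exists_btwn_real (K : Subfield ℝ) {x y : ℝ} (h : x < y) :
    ∃ k : K, x < k ∧ (k : ℝ) < y := by
  obtain ⟨p, h1, h2⟩ := exists_rat_btwn h
  exact ⟨(p : K), by simpa using h1, by simpa using h2⟩

/-- Turns closure into a first-order condition on the order, so that `EntersBefore` becomes
definable. -/
theorem mem_closure_iff_Ioo_of_subfield {s : Set K} {c : K} :
    c ∈ closure s ↔ ∀ a b, a < c → c < b → ∃ y, y ∈ s ∧ a < y ∧ y < b := by
  rw [mem_closure_iff]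
  constructor
  · intro h a b ha hb
    obtain ⟨y, hy, hys⟩ := h _ (isOpen_Ioo (a := a) (b := b)) ⟨ha, hb⟩
    exact ⟨y, hys, hy.1, hy.2⟩
  · intro h o ho hc
    obtain ⟨ε, hε, hball⟩ := Metric.isOpen_iff.1 ho c hc
    obtain ⟨a, ha, ha'⟩ := K.exists_btwn_real (sub_lt_self (c : ℝ) hε)
    obtain ⟨b, hb, hb'⟩ := K.exists_btwn_real (lt_add_of_pos_right (c : ℝ) hε)
    obtain ⟨y, hy, hay, hyb⟩ := h a b ha' hb
    refine ⟨y, hball ?_, hy⟩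
    have h1 : (a : ℝ) < y := hay
    have h2 : (y : ℝ) < b := hyb
    rw [Metric.mem_ball, Subtype.dist_eq, Real.dist_eq, abs_lt]
    constructor <;> linarith

/-- A positive element `t` of `K` is a square if the projection of the conic `z² + t y² = t²` has a
supremum in `K`. -/
theorem Subfield.exists_sq_eq_of_isLUB {t b : K} (ht : 0 < t)
    (hb : IsLUB {y : K | ∃ z : K, t * t = z * z + t * (y * y)} b) : t = b * b := by
  have ht' : (0 : ℝ) < t := ht
  have hsq := Real.mul_self_sqrt ht'.le
  have hpos := Real.sqrt_pos.2 ht'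
  set s := √(t : ℝ) with hs
  have hbs : (b : ℝ) = s := by
    apply le_antisymm
    · by_contra! hlt
      obtain ⟨k, hk, hk'⟩ := K.exists_btwn_real hlt
      have hub : k ∈ upperBounds {y : K | ∃ z : K, t * t = z * z + t * (y * y)} := by
        rintro y ⟨z, hz⟩
        have hz' : (t : ℝ) * t = z * z + t * (y * y) := by exact_mod_cast congrArg Subtype.val hz
        refine le_trans (b := s) (α := ℝ) ?_ hk.le
        refine abs_le_of_sq_le_sq' ?_ hpos.le |>.2
        have : (t : ℝ) * (y * y) ≤ t * t := by nlinarith [mul_self_nonneg (z : ℝ)]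
        nlinarith [le_of_mul_le_mul_left this ht']
      exact absurd (hb.2 hub) (not_le.2 hk')
    · by_contra! hlt
      -- The conic has the rational parametrization y = 2xt/(x² + t), z = t(x² - t)/(x² + t), and y
      -- = √t at x = √t. Parameters in K near √t thus give points of the projection near √t.
      have hcont : ContinuousAt (fun x : ℝ => 2 * x * t / (x * x + t)) s := by
        refine ContinuousAt.div (by fun_prop) (by fun_prop) ?_
        positivity
      have hval : 2 * s * t / (s * s + t) = s := by
        rw [hsq]; field_simp; norm_num
      have hev := hcont.eventually (lt_mem_nhds (a := (b : ℝ)) (by simpa only [hval] using hlt))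
      obtain ⟨ε, hε, hball⟩ := Metric.eventually_nhds_iff.1 hev
      obtain ⟨x, hx, hx'⟩ := K.exists_btwn_real (lt_add_of_pos_right s hε)
      have hgt := hball (y := (x : ℝ)) (by rw [Real.dist_eq, abs_lt]; constructor <;> linarith)
      have hne : x * x + t ≠ 0 := (add_pos_of_nonneg_of_pos (mul_self_nonneg x) ht).ne'
      have hle : 2 * x * t / (x * x + t) ≤ b := hb.1 ⟨t * (x * x - t) / (x * x + t), by
        field_simp; ring⟩
      exact absurd hle (not_le.2 (show (b : ℝ) < ((2 * x * t / (x * x + t) : K) : ℝ) by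
        push_cast; exact hgt))
  apply Subtype.ext
  rw [← hsq, ← hbs]
  rfl

end SubfieldReal

/-! ### Definability of the field operations and of the order -/

section Expansion

variable {K : Subfield ℝ} [FirstOrder.Ring.CompatibleRing K]
  {L : FirstOrder.Language.{u, v}} [L.Structure K]

open FirstOrder

theorem defFun_add (φ : Language.ring →ᴸ L) [φ.IsExpansionOn K] :
    DefFun L fun v : Fin 2 → K => v 0 + v 1 := by
  have h : (fun v : Fin 2 → K => v 0 + v 1) =
      Language.Structure.funMap (φ.onFunction Ring.addFunc) := by
    ext v; simp
  exact ⟨h ▸ (Set.DefinableFun.fun_symbol _).of_empty⟩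

theorem defFun_mul (φ : Language.ring →ᴸ L) [φ.IsExpansionOn K] :
    DefFun L fun v : Fin 2 → K => v 0 * v 1 := by
  have h : (fun v : Fin 2 → K => v 0 * v 1) =
      Language.Structure.funMap (φ.onFunction Ring.mulFunc) := by
    ext v; simp
  exact ⟨h ▸ (Set.DefinableFun.fun_symbol _).of_empty⟩

/-- In a definably complete expansion of a subfield of `ℝ`, the order is definable, since the
nonnegative elements are the squares. -/
theorem defOrder_of_isDefinablyComplete (φ : Language.ring →ᴸ L) [φ.IsExpansionOn K]
    (hK : IsDefinablyComplete L K) : DefOrder L K := by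
  have hadd : DefFun L fun v : Fin 2 → K => v 0 + v 1 := defFun_add φ
  have hmul : DefFun L fun v : Fin 2 → K => v 0 * v 1 := defFun_mul φ
  have iadd {α : Type} {f g : (α → K) → K} [hf : DefFun L f] [hg : DefFun L g] :
      DefFun L (fun v => f v + g v) :=
    ⟨Set.DefinableFun.comp (g := fun v => ![f v, g v])
      (by simp [Set.DefinableMap, hf.out, hg.out]) hadd.out⟩
  have imul {α : Type} {f g : (α → K) → K} [hf : DefFun L f] [hg : DefFun L g] :
      DefFun L (fun v => f v * g v) :=
    ⟨Set.DefinableFun.comp (g := fun v => ![f v, g v])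
      (by simp [Set.DefinableMap, hf.out, hg.out]) hmul.out⟩
  have hsq : ∀ t : K, 0 < t → ∃ b, t = b * b := by
    intro t ht
    -- The order is not yet known to be definable, so a conic, given by ring operations alone,
    -- stands in for the condition y² ≤ t.
    have hS : DefRel₁ L fun y : K => ∃ z : K, t * t = z * z + t * (y * y) := by
      unfold DefRel₁; infer_instance
    have hbd : ∀ y : K, (∃ z : K, t * t = z * z + t * (y * y)) → y * y ≤ t := by
      rintro y ⟨z, hz⟩
      by_contra! hlt
      nlinarith [mul_self_nonneg z, mul_lt_mul_of_pos_left hlt ht]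
    obtain ⟨b, hb⟩ := hK {y | ∃ z : K, t * t = z * z + t * (y * y)} hS.out ⟨0, t, by ring⟩
      ⟨-(t + 1), fun y hy => by nlinarith [hbd y hy]⟩ ⟨t + 1, fun y hy => by nlinarith [hbd y hy]⟩
    exact ⟨b, Subfield.exists_sq_eq_of_isLUB ht hb⟩
  have hle : DefRel₂ L fun x y : K => ∃ z, y = x + z * z := by
    unfold DefRel₂; infer_instance
  refine ⟨DefPred.congr hle fun v => ⟨fun h => ?_, ?_⟩⟩
  · rcases h.eq_or_lt with h | h
    · exact ⟨0, by simp [h]⟩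
    · obtain ⟨b, hb⟩ := hsq _ (sub_pos.2 h)
      exact ⟨b, by rw [← hb]; ring⟩
  · rintro ⟨z, hz⟩
    rw [hz]
    exact le_add_of_nonneg_right (mul_self_nonneg z)

end Expansion

/-! ### The preorder of a definable cover, and the theorem -/

/-- `x` enters the closures of the sets `Y_t`, for increasing `t > 0`, no later than `y`. -/
def EntersBefore {K : Type w} [LinearOrder K] [Zero K] [TopologicalSpace K] (Y : Set (K × K))
    (x y : K) : Prop :=
  ∀ t, 0 < t → y ∈ closure (fibre Y t) → x ∈ closure (fibre Y t)

/-- Totality holds because the closures form a chain. The initial segment of `x` is the intersection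
of the closures that contain `x`, hence closed; since `x` lies in some fibre, it is contained in a
single nowhere dense closure. -/
theorem isSparsePreorder_entersBefore {K : Subfield ℝ} {Y : Set (K × K)}
    (hY : ∀ t : K, 0 < t → IsNowhereDense (fibre Y t))
    (hmono : ∀ s t : K, 0 < s → s < t → fibre Y s ⊆ fibre Y t)
    (hcover : (⋃ t ∈ Set.Ioi (0 : K), fibre Y t) = Set.univ) :
    IsSparsePreorder (EntersBefore Y) where
  total x y := by
    by_contra! h
    simp only [EntersBefore] at h
    push Not at h
    obtain ⟨⟨s, hs, hys, hxs⟩, t, ht, hxt, hyt⟩ := h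
    rcases lt_trichotomy s t with hst | rfl | hst
    · exact hyt (closure_mono (hmono s t hs hst) hys)
    · exact hxs hxt
    · exact hxs (closure_mono (hmono t s ht hst) hxt)
  trans x y z hxy hyz t ht hz := hxy t ht (hyz t ht hz)
  closed x z hz := by
    simp only [EntersBefore] at hz
    push Not at hz
    obtain ⟨t, ht, hx, hz⟩ := hz
    rw [mem_closure_iff_Ioo_of_subfield] at hz
    push Not at hz
    obtain ⟨a, b, ha, hb, hab⟩ := hz
    refine ⟨a, b, ha, hb, fun c hac hcb hc => ?_⟩
    obtain ⟨y, hy, hay, hyb⟩ := mem_closure_iff_Ioo_of_subfield.1 (hc t ht hx) a b hac hcb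
    exact absurd hyb (hab y hy hay).not_gt
  sparse x a b hab := by
    obtain ⟨t, ht, hx⟩ : ∃ t : K, 0 < t ∧ x ∈ fibre Y t := by
      have := hcover ▸ Set.mem_univ x
      simpa using this
    by_contra! hcon
    obtain ⟨c, hc⟩ := exists_between hab
    have hsub : Set.Ioo a b ⊆ interior (closure (fibre Y t)) :=
      interior_maximal (fun c hc => hcon c hc.1 hc.2 t ht (subset_closure hx)) isOpen_Ioo
    rw [hY t ht] at hsub
    exact hsub hc

/-- An expansion of `K` is a structure on `K` in a language `L` that contains the language of rings
(through `φ`), whose symbols are interpreted as the field operations of `K`. The language `L` may,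
but need not, name the order of `K`. The order and the topology on `K` are induced by `ℝ`. -/
theorem theoremD (K : Subfield ℝ) [FirstOrder.Ring.CompatibleRing K]
    (L : FirstOrder.Language.{u, v}) [L.Structure K]
    (φ : FirstOrder.Language.ring →ᴸ L) [φ.IsExpansionOn K]
    (hK : IsDefinablyComplete L K) :
    IsDefinablyBaire L K := by
  rintro ⟨Y, hdef, hY, hmono, hcover⟩
  have := defOrder_of_isDefinablyComplete φ hK
  have := defFun_add (K := K) φ
  have hYd : DefRel₂ L fun b t : K => b ∈ fibre Y t := ⟨hdef⟩
  have iY {α : Type} {f g : (α → K) → K} [DefFun L f] [DefFun L g] :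
    DefPred L (fun v => f v ∈ fibre Y (g v)) := hYd.comp
  refine (isSparsePreorder_entersBefore hY hmono hcover).false_of_isDefinablyComplete hK ?_
  unfold DefRel₂ EntersBefore
  simp only [mem_closure_iff_Ioo_of_subfield]
  infer_instance
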